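/- Let $X$ be a real separated (Hausdorff) locally convex space with topological dual $X^*$, and let $X^*$ carry any locally convex vector space topology compatible with the duality pair $(X,X^*)$, i.e. one whose continuous linear functionals are exactly the evaluations $x^*\mapsto\langle x^*,x\rangle$, $x\in X$ (for example the weak* topology). Let $T$ be a nonempty set, let $c,a_t\in X^*$ and $b_t\in\mathbb R$ for $t\in T$, and consider the linear infinite program $$(\mathrm{PL})\qquad \inf\ \langle c,x\rangle\quad\text{s.t.}\quad \langle a_t,x\rangle\le b_t,\ t\in T.$$ Put $f:=\sup_{t\in T}(\langle a_t,\cdot\rangle-b_t)$ and $T_\varepsilon(x):=\{t\in T:\langle a_t,x\rangle-b_t\ge f(x)-\varepsilon\}$ for $\varepsilon>0$. Here $\overline{\mathrm{co}}$ denotes the closed convex hull in $X^*$, and the recession cone of a nonempty closed convex set $A$ is $[A]_\infty:=\bigcap_{s>0}s(A-a)$, where $a\in A$ is arbitrary. Assume the Slater condition: there is $x_0\in X$ with $f(x_0)<0$. Let $x$ be a feasible point of $(\mathrm{PL})$ (so that $f(x)$ is a real number and $f(x)\le0$). Then $x$ is optimal for $(\mathrm{PL})$ if and only if both of the following hold: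 (a) if $f(x)<0$, then $$-c\in\left[\overline{\mathrm{co}}\left\{\frac{\varepsilon\,a_t}{\max\{2f(x)-2(\langle a_t,x\rangle-b_t)-\varepsilon,\ \varepsilon\}}:t\in T\right\}\right]_\infty\quad\text{for all }\varepsilon>0;\tag{1}$$ (b) if $f(x)=0$, then either (1) holds, or there exists $\lambda>0$ such that $$-\lambda c\in\bigcap_{\varepsilon>0}\overline{\mathrm{co}}\left(\{a_t:t\in T_\varepsilon(x)\}+\left(\left\{\frac{-\varepsilon^2a_t}{2(\langle a_t,x\rangle-b_t)-2f(x)+\varepsilon}:t\in T\setminus T_\varepsilon(x)\right\}\cup\{0\}\right)\right).$$ -/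

import Mathlib

open Set Topology
open scoped Pointwise

namespace LinearInfiniteProgram

/-- A topology `τ` on the dual `X*` is compatible with the duality pair `(X, X*)` if it is a locally
convex vector space topology whose continuous linear functionals are exactly the evaluations
`x* ↦ ⟨x*, x⟩` at the points `x` of `X`. -/
structure IsCompatibleTopology {X : Type*} [AddCommGroup X] [Module ℝ X] [TopologicalSpace X]
    (τ : TopologicalSpace (StrongDual ℝ X)) : Prop where
  isTopologicalAddGroup : @IsTopologicalAddGroup (StrongDual ℝ X) τ _
  continuousSMul : @ContinuousSMul ℝ (StrongDual ℝ X) _ _ τ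
  locallyConvexSpace : @LocallyConvexSpace ℝ (StrongDual ℝ X) _ _ _ _ τ
  continuous_iff : ∀ φ : StrongDual ℝ X →ₗ[ℝ] ℝ,
    Continuous[τ, inferInstance] φ ↔ ∃ x : X, ∀ p : StrongDual ℝ X, φ p = p x

/-- The closed convex hull of `S` with respect to the topology `τ`. -/
def closedCo {E : Type*} [AddCommGroup E] [Module ℝ E] (τ : TopologicalSpace E) (S : Set E) :
    Set E :=
  closure[τ] (convexHull ℝ S)

open Classical in
/-- The recession cone `⋂_{t > 0} t (A - a)`, `a ∈ A`, of a closed convex set `A`; for a nonempty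
closed convex set it does not depend on the choice of the base point `a`. The recession cone of the
empty set is `{0}` by convention. -/
def recessionCone {E : Type*} [AddCommGroup E] [Module ℝ E] (A : Set E) : Set E :=
  if A.Nonempty then {v | ∃ a ∈ A, ∀ t : ℝ, 0 < t → v ∈ t • (A - {a})} else {0}

section Program

variable {X T : Type*} [AddCommGroup X] [Module ℝ X] [TopologicalSpace X]

/-- The constraint function `f_t = ⟨a_t, ·⟩ - b_t`. -/
def constraint (a : T → StrongDual ℝ X) (b : T → ℝ) (t : T) (x : X) : ℝ := a t x - b t

/-- The supremum function `f = sup_t (⟨a_t, ·⟩ - b_t)`, with extended real values. -/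
noncomputable def supFn (a : T → StrongDual ℝ X) (b : T → ℝ) (x : X) : EReal :=
  ⨆ t, (constraint a b t x : EReal)

/-- The feasible set `{x | ⟨a_t, x⟩ ≤ b_t for all t}`. -/
def feasibleSet (a : T → StrongDual ℝ X) (b : T → ℝ) : Set X := {x | ∀ t, a t x ≤ b t}

/-- The point `x` is optimal for minimizing `⟨c, ·⟩` over the feasible set. -/
def IsOptimal (c : StrongDual ℝ X) (a : T → StrongDual ℝ X) (b : T → ℝ) (x : X) : Prop :=
  x ∈ feasibleSet a b ∧ IsMinOn (fun y => c y) (feasibleSet a b) x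

/-- The Slater condition: `f x₀ < 0` for some `x₀` (the supremum itself is negative). -/
def Slater (a : T → StrongDual ℝ X) (b : T → ℝ) : Prop := ∃ x₀ : X, supFn a b x₀ < 0

/-- The set `T_ε(x)` of `ε`-active indices: `f_t(x) ≥ f(x) - ε`. -/
def activeSet (a : T → StrongDual ℝ X) (b : T → ℝ) (ε : ℝ) (x : X) : Set T :=
  {t | supFn a b x - (ε : EReal) ≤ (constraint a b t x : EReal)}

/-- The set of all `ε a_t / max {2 f(x) - 2 f_t(x) - ε, ε}`, `t ∈ T`. It is used only at feasible
points `x`, with `T` nonempty, where `f(x)` is a real number. -/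
noncomputable def weightedSet (a : T → StrongDual ℝ X) (b : T → ℝ) (ε : ℝ) (x : X) :
    Set (StrongDual ℝ X) :=
  range fun t => (ε / max (2 * (supFn a b x).toReal - 2 * constraint a b t x - ε) ε) • a t

/-- The set of all `-ε² a_t / (2 f_t(x) - 2 f(x) + ε)`, `t ∉ T_ε(x)`. It is used only at feasible
points `x`, with `T` nonempty, where `f(x)` is a real number. -/
noncomputable def penalizedSet (a : T → StrongDual ℝ X) (b : T → ℝ) (ε : ℝ) (x : X) :
    Set (StrongDual ℝ X) :=
  (fun t => (-ε ^ 2 / (2 * constraint a b t x - 2 * (supFn a b x).toReal + ε)) • a t) ''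
    (activeSet a b ε x)ᶜ

/-- The first condition: `-c` lies in the recession cone of the closed convex hull of the weighted
`a_t`, for every `ε > 0`. -/
def RecessionCondition (τ : TopologicalSpace (StrongDual ℝ X)) (c : StrongDual ℝ X)
    (a : T → StrongDual ℝ X) (b : T → ℝ) (x : X) : Prop :=
  ∀ ε : ℝ, 0 < ε → -c ∈ recessionCone (closedCo τ (weightedSet a b ε x))

/-- The second condition: for some `λ > 0`, `-λ c` lies in the intersection over `ε > 0` of the closed
convex hulls of `{a_t : t ∈ T_ε(x)} + ({penalized a_t : t ∉ T_ε(x)} ∪ {0})`. -/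
def MultiplierCondition (τ : TopologicalSpace (StrongDual ℝ X)) (c : StrongDual ℝ X)
    (a : T → StrongDual ℝ X) (b : T → ℝ) (x : X) : Prop :=
  ∃ l : ℝ, 0 < l ∧ -(l • c) ∈
    ⋂ (ε : ℝ) (_ : 0 < ε), closedCo τ (a '' activeSet a b ε x + (penalizedSet a b ε x ∪ {0}))

end Program

end LinearInfiniteProgram

/-! By Hahn–Banach, closed convex hulls in `X*` are tested by points `d` of `X`, so both conditions
become inequalities on `X`: the recession condition says that `x` minimizes `c` over the domain of
`f` (`recessionCondition_iff`), and the intersection of hulls is the subdifferential of `f` at `x`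
(`mem_iInter_closedCo_iff`). Pairs `(y, r)` with every `f_t(y) ≤ r` run through the epigraph of `f`.
What remains is Lagrange duality: under Slater, optimality yields `μ ≥ 0` with `c x ≤ c y + μ r` on
the epigraph (`exists_multiplier`). If `f(x) < 0`, complementary slackness forces `μ = 0`, the
recession condition; if `f(x) = 0` and `μ > 0`, then `λ = 1/μ` gives the subgradient. -/

namespace LinearInfiniteProgram

/-- A point lies in the closed convex hull of `S` iff every upper bound on `S` of a continuous linear
functional is an upper bound of that functional at the point. -/
theorem mem_closure_convexHull_iff {E : Type*} [AddCommGroup E] [Module ℝ E] [TopologicalSpace E]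
    [IsTopologicalAddGroup E] [ContinuousSMul ℝ E] [LocallyConvexSpace ℝ E] {S : Set E} {v : E} :
    v ∈ closure (convexHull ℝ S) ↔
      ∀ (φ : StrongDual ℝ E) (M : ℝ), (∀ s ∈ S, φ s ≤ M) → φ v ≤ M := by
  constructor
  · intro hv φ M hM
    have hconv : Convex ℝ {p : E | φ p ≤ M} :=
      convex_halfSpace_le (f := φ) φ.toLinearMap.isLinear M
    have hclosed : IsClosed {p : E | φ p ≤ M} := isClosed_le φ.continuous continuous_const
    exact closure_minimal (convexHull_min hM hconv) hclosed hv
  · intro h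
    by_contra hv
    obtain ⟨φ, u, hu, huv⟩ := geometric_hahn_banach_closed_point
      (convex_convexHull ℝ S).closure isClosed_closure hv
    exact absurd (h φ u fun s hs => (hu s (subset_closure (subset_convexHull ℝ S hs))).le)
      (not_le.mpr huv)

/-! ### Support-functional tests for hulls and recession cones -/

section Dual

variable {X : Type*} [AddCommGroup X] [Module ℝ X] [TopologicalSpace X]

/-- Membership in the closed convex hull for a compatible topology is tested by points of `X`. -/
theorem IsCompatibleTopology.mem_closedCo_iff {τ : TopologicalSpace (StrongDual ℝ X)}
    (hτ : IsCompatibleTopology τ) {S : Set (StrongDual ℝ X)} {v : StrongDual ℝ X} :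
    v ∈ closedCo τ S ↔ ∀ (d : X) (M : ℝ), (∀ s ∈ S, s d ≤ M) → v d ≤ M := by
  have key := @mem_closure_convexHull_iff (StrongDual ℝ X) _ _ τ hτ.isTopologicalAddGroup
    hτ.continuousSMul hτ.locallyConvexSpace S v
  refine Iff.trans key ⟨fun h d M hM => ?_, fun h φ M hM => ?_⟩
  · let ψ : StrongDual ℝ X →ₗ[ℝ] ℝ :=
      { toFun := fun p => p d, map_add' := fun _ _ => rfl, map_smul' := fun _ _ => rfl }
    exact h (@ContinuousLinearMap.mk ℝ ℝ _ _ (RingHom.id ℝ) (StrongDual ℝ X) τ _ ℝ _ _ _ _ ψ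
      ((hτ.continuous_iff ψ).mpr ⟨d, fun _ => rfl⟩)) M hM
  · obtain ⟨d, hd⟩ := (hτ.continuous_iff φ.toLinearMap).mp φ.cont
    have hd' : ∀ p, φ p = p d := hd
    rw [hd']
    exact h d M fun s hs => (hd' s) ▸ hM s hs

/-- The recession cone of a nonempty closed convex hull consists of the functionals that are
nonpositive on the barrier cone of the generating set. -/
theorem IsCompatibleTopology.mem_recessionCone_closedCo_iff
    {τ : TopologicalSpace (StrongDual ℝ X)} (hτ : IsCompatibleTopology τ)
    {S : Set (StrongDual ℝ X)} (hS : S.Nonempty) {v : StrongDual ℝ X} :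
    v ∈ recessionCone (closedCo τ S) ↔
      ∀ (d : X) (M : ℝ), (∀ s ∈ S, s d ≤ M) → v d ≤ 0 := by
  obtain ⟨p, hp⟩ := hS
  have hpA : p ∈ closedCo τ S := hτ.mem_closedCo_iff.mpr fun d M hM => hM p hp
  rw [recessionCone, if_pos ⟨p, hpA⟩]
  simp only [mem_ofPred_eq]
  constructor
  · rintro ⟨q, -, hq⟩ d M hM
    by_contra! hvd
    -- The ray `q + r v` stays in the hull, where `d` is bounded by `M`; a positive slope `v d`
    -- would violate this for large `r`.
    have hbound : ∀ r : ℝ, 0 < r → q d + r * v d ≤ M := by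
      intro r hr
      obtain ⟨w, hw, hwv⟩ := mem_smul_set.mp (hq r⁻¹ (inv_pos.mpr hr))
      obtain ⟨z, hz, q', hq', rfl⟩ := mem_sub.mp hw
      rw [mem_singleton_iff.mp hq'] at hwv
      have hz := hτ.mem_closedCo_iff.mp hz d M hM
      have hv : v d = r⁻¹ * (z d - q d) := by rw [← hwv]; rfl
      rw [hv, mul_inv_cancel_left₀ hr.ne']
      linarith
    have h := hbound ((|M - q d| + 1) / v d) (by positivity)
    rw [div_mul_cancel₀ _ hvd.ne'] at h
    linarith [le_abs_self (M - q d)]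
  · intro h
    refine ⟨p, hpA, fun t ht => mem_smul_set.mpr ⟨t⁻¹ • v, ?_, smul_inv_smul₀ ht.ne' v⟩⟩
    refine mem_sub.mpr ⟨p + t⁻¹ • v, ?_, p, rfl, add_sub_cancel_left _ _⟩
    refine hτ.mem_closedCo_iff.mpr fun d M hM => ?_
    have h1 : t⁻¹ * v d ≤ 0 := mul_nonpos_of_nonneg_of_nonpos (inv_pos.mpr ht).le (h d M hM)
    have h2 := hM p hp
    change p d + t⁻¹ * v d ≤ M
    linarith

end Dual

/-! ### The supremum function, its domain and its subdifferential -/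

section Program

variable {X T : Type*} [AddCommGroup X] [Module ℝ X] [TopologicalSpace X]
  {a : T → StrongDual ℝ X} {b : T → ℝ}

theorem constraint_add_smul (t : T) (x d : X) (s : ℝ) :
    constraint a b t (x + s • d) = constraint a b t x + s * a t d := by
  simp only [constraint, map_add, map_smul, smul_eq_mul]
  ring

theorem supFn_le_coe_iff {x : X} {r : ℝ} :
    supFn a b x ≤ (r : EReal) ↔ ∀ t, constraint a b t x ≤ r := by
  simp only [supFn, iSup_le_iff, EReal.coe_le_coe_iff]

theorem supFn_ne_bot [Nonempty T] (x : X) : supFn a b x ≠ ⊥ := by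
  obtain ⟨t⟩ := ‹Nonempty T›
  intro h
  have : (constraint a b t x : EReal) ≤ ⊥ := h ▸ le_iSup (fun t => (constraint a b t x : EReal)) t
  exact EReal.coe_ne_bot _ (le_bot_iff.mp this)

theorem mem_feasibleSet_iff {x : X} :
    x ∈ feasibleSet a b ↔ ∀ t, constraint a b t x ≤ 0 := by
  simp only [feasibleSet, constraint, mem_ofPred_eq, sub_nonpos]

theorem coe_toReal_supFn [Nonempty T] {x : X} (hx : x ∈ feasibleSet a b) :
    ((supFn a b x).toReal : EReal) = supFn a b x := by
  refine EReal.coe_toReal (fun h => ?_) (supFn_ne_bot x)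
  have := supFn_le_coe_iff.mpr (mem_feasibleSet_iff.mp hx)
  rw [h] at this
  exact EReal.coe_ne_top _ (top_le_iff.mp this)

/-- The barrier cone of the weighted set at `x` is the
cone of feasible directions of the domain of `f` at `x`. -/
theorem weightedSet_bddAbove_iff {x : X} {F ε : ℝ} (hF : (F : EReal) = supFn a b x) (hε : 0 < ε)
    (d : X) :
    (∃ M : ℝ, ∀ p ∈ weightedSet a b ε x, p d ≤ M) ↔
      ∃ s : ℝ, 0 < s ∧ ∃ r : ℝ, ∀ t, constraint a b t (x + s • d) ≤ r := by
  have hle : ∀ t, constraint a b t x ≤ F := supFn_le_coe_iff.mp hF.ge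
  have hFr : (supFn a b x).toReal = F := by rw [← hF, EReal.toReal_coe]
  simp only [weightedSet, forall_mem_range, hFr, constraint_add_smul,
    smul_apply, smul_eq_mul]
  have hmax : ∀ t, 0 < max (2 * F - 2 * constraint a b t x - ε) ε :=
    fun t => hε.trans_le (le_max_right _ _)
  have hiff : ∀ t M, ε / max (2 * F - 2 * constraint a b t x - ε) ε * a t d ≤ M ↔
      ε * a t d ≤ M * max (2 * F - 2 * constraint a b t x - ε) ε := fun t M => by
    rw [div_mul_eq_mul_div, div_le_iff₀ (hmax t)]
  simp only [hiff]
  constructor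
  · rintro ⟨M, hM⟩
    have hN : 0 < |M| + 1 := by positivity
    -- The maximum is at most `2 (F - f_t(x)) + ε`, so this step length increases `f_t` by at most
    -- `F - f_t(x) + ε / 2`.
    refine ⟨ε / (2 * (|M| + 1)), by positivity, F + ε / 2, fun t => ?_⟩
    have h1 : ε * a t d ≤ (|M| + 1) * (2 * F - 2 * constraint a b t x + ε) :=
      (hM t).trans <| mul_le_mul (by linarith [le_abs_self M])
        (max_le (by linarith) (by linarith [hle t])) (hmax t).le hN.le
    have h2 : ε / (2 * (|M| + 1)) * a t d ≤ (2 * F - 2 * constraint a b t x + ε) / 2 := by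
      rw [div_mul_eq_mul_div, div_le_iff₀ (by positivity)]
      linarith
    linarith
  · rintro ⟨s, hs, r, hr⟩
    refine ⟨(ε + |r - F|) / s, fun t => ?_⟩
    rw [div_mul_eq_mul_div, le_div_iff₀ hs]
    have hm1 := le_max_left (2 * F - 2 * constraint a b t x - ε) ε
    have hm2 := le_max_right (2 * F - 2 * constraint a b t x - ε) ε
    set m := max (2 * F - 2 * constraint a b t x - ε) ε
    -- Averaging the two lower bounds on `m` gives `m ≥ F - f_t(x)`.
    have h1 : s * a t d ≤ m + |r - F| := by linarith [hr t, le_abs_self (r - F)]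
    have h2 : ε * (s * a t d) ≤ ε * (m + |r - F|) := mul_le_mul_of_nonneg_left h1 hε.le
    have h3 : ε * |r - F| ≤ m * |r - F| := mul_le_mul_of_nonneg_right hm2 (abs_nonneg _)
    linarith

/-- The recession condition says that `x` minimizes `c` over the domain of `f`. -/
theorem recessionCondition_iff [Nonempty T] {τ : TopologicalSpace (StrongDual ℝ X)}
    (hτ : IsCompatibleTopology τ) (c : StrongDual ℝ X) {x : X} (hx : x ∈ feasibleSet a b) :
    RecessionCondition τ c a b x ↔
      ∀ (y : X) (r : ℝ), (∀ t, constraint a b t y ≤ r) → c x ≤ c y := by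
  have hF := coe_toReal_supFn hx
  have hne : ∀ ε, (weightedSet a b ε x).Nonempty := fun ε => range_nonempty _
  constructor
  · intro h y r hy
    -- One value of `ε` suffices: the barrier cone of the weighted set does not depend on `ε`.
    obtain ⟨M, hM⟩ := (weightedSet_bddAbove_iff hF one_pos (y - x)).mpr
      ⟨1, one_pos, r, by simpa using hy⟩
    have := (hτ.mem_recessionCone_closedCo_iff (hne 1)).mp (h 1 one_pos) _ M hM
    simp only [neg_apply, map_sub] at this
    linarith
  · intro h ε hε
    refine (hτ.mem_recessionCone_closedCo_iff (hne ε)).mpr fun d M hM => ?_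
    obtain ⟨s, hs, r, hr⟩ := (weightedSet_bddAbove_iff hF hε d).mp ⟨M, hM⟩
    have := h _ r hr
    rw [map_add, map_smul, smul_eq_mul] at this
    have : 0 ≤ c d := nonneg_of_mul_nonneg_right (by linarith) hs
    simpa using this

/-- The subdifferential of `f` at `x` as an intersection of closed convex hulls. -/
theorem mem_iInter_closedCo_iff {τ : TopologicalSpace (StrongDual ℝ X)}
    (hτ : IsCompatibleTopology τ) {x : X} {F : ℝ} (hF : (F : EReal) = supFn a b x)
    {v : StrongDual ℝ X} :
    v ∈ ⋂ (ε : ℝ) (_ : 0 < ε), closedCo τ (a '' activeSet a b ε x + (penalizedSet a b ε x ∪ {0})) ↔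
      ∀ (y : X) (r : ℝ), (∀ t, constraint a b t y ≤ r) → v (y - x) ≤ r - F := by
  have hle : ∀ t, constraint a b t x ≤ F := supFn_le_coe_iff.mp hF.ge
  have hFr : (supFn a b x).toReal = F := by rw [← hF, EReal.toReal_coe]
  have hact : ∀ ε t, t ∈ activeSet a b ε x ↔ F - ε ≤ constraint a b t x := fun ε t => by
    rw [activeSet, mem_ofPred_eq, ← hF, ← EReal.coe_sub, EReal.coe_le_coe_iff]
  simp only [mem_iInter]
  constructor
  · intro h y r hy
    set δ := r - F with hδ
    have hdir : ∀ t, a t (y - x) ≤ δ + (F - constraint a b t x) := fun t => by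
      have := hy t
      simp only [constraint, map_sub] at this ⊢
      linarith
    -- An active generator contributes at most `δ + ε`, a penalized one at most `ε (|δ| + ε)`; the
    -- excess over `δ` vanishes as `ε → 0`.
    have hε : ∀ ε : ℝ, 0 < ε → v (y - x) ≤ δ + ε * (1 + |δ| + ε) := by
      intro ε hε
      refine hτ.mem_closedCo_iff.mp (h ε hε) (y - x) _ fun s hs => ?_
      obtain ⟨p, ⟨t, ht, rfl⟩, q, hq, rfl⟩ := mem_add.mp hs
      have h1 : a t (y - x) ≤ δ + ε := by linarith [hdir t, (hact ε t).mp ht]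
      have h2 : q (y - x) ≤ ε * (|δ| + ε) := by
        rcases hq with ⟨u, hu, rfl⟩ | hq
        · have hu' : constraint a b u x < F - ε := not_le.mp fun h => hu ((hact ε u).mpr h)
          have hden : 0 < 2 * (F - constraint a b u x) - ε := by linarith
          have hrw : -ε ^ 2 / (2 * constraint a b u x - 2 * F + ε) =
              ε ^ 2 / (2 * (F - constraint a b u x) - ε) := by
            rw [← neg_div_neg_eq]
            congr 1 <;> ring
          simp only [hFr, hrw, smul_apply, smul_eq_mul]
          rw [div_mul_eq_mul_div, div_le_iff₀ hden]
          have hd := hdir u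
          set g := F - constraint a b u x
          have hg : ε ≤ 2 * g - ε := by linarith
          have h3 : ε ^ 2 * a u (y - x) ≤ ε ^ 2 * (|δ| + g) :=
            mul_le_mul_of_nonneg_left (by linarith [le_abs_self δ]) (sq_nonneg ε)
          have h4 : ε * |δ| * ε ≤ ε * |δ| * (2 * g - ε) :=
            mul_le_mul_of_nonneg_left hg (by positivity)
          have h5 : ε ^ 2 * g ≤ ε ^ 2 * (2 * g - ε) :=
            mul_le_mul_of_nonneg_left (by linarith) (sq_nonneg ε)
          linarith
        · rw [mem_singleton_iff.mp hq, zero_apply]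
          positivity
      rw [add_apply]
      linarith
    have hlim : Filter.Tendsto (fun ε : ℝ => δ + ε * (1 + |δ| + ε)) (𝓝[>] 0) (𝓝 δ) := by
      have hc : Continuous fun ε : ℝ => δ + ε * (1 + |δ| + ε) := by fun_prop
      simpa using (hc.tendsto 0).mono_left nhdsWithin_le_nhds
    exact ge_of_tendsto hlim (by filter_upwards [self_mem_nhdsWithin] with ε h using hε ε h)
  · intro h ε hε
    refine hτ.mem_closedCo_iff.mpr fun d M hM => ?_
    obtain ⟨t₀, ht₀⟩ : ∃ t, F - ε < constraint a b t x := by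
      by_contra! hcon
      have := supFn_le_coe_iff.mpr hcon
      rw [← hF, EReal.coe_le_coe_iff] at this
      linarith
    have ht₀ : t₀ ∈ activeSet a b ε x := (hact ε t₀).mpr ht₀.le
    have hMact : ∀ t ∈ activeSet a b ε x, ∀ q ∈ penalizedSet a b ε x ∪ {0},
        a t d + q d ≤ M := fun t ht q hq => hM _ (add_mem_add (mem_image_of_mem a ht) hq)
    -- The summand `0` isolates the active terms; fixing the active index `t₀` then bounds the
    -- penalized ones.
    have hM0 : ∀ t ∈ activeSet a b ε x, a t d ≤ M := fun t ht => by
      simpa using hMact t ht 0 (Or.inr rfl)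
    set ρ := |M - a t₀ d|
    have hρ : 0 ≤ ρ := abs_nonneg _
    have hpen : ∀ u ∉ activeSet a b ε x,
        ε ^ 2 * a u d ≤ ρ * (2 * (F - constraint a b u x) - ε) := by
      intro u hu
      have hu' : constraint a b u x < F - ε := not_le.mp fun h => hu ((hact ε u).mpr h)
      have hden : 0 < 2 * (F - constraint a b u x) - ε := by linarith
      have hrw : -ε ^ 2 / (2 * constraint a b u x - 2 * F + ε) =
          ε ^ 2 / (2 * (F - constraint a b u x) - ε) := by
        rw [← neg_div_neg_eq]
        congr 1 <;> ring
      have := hMact t₀ ht₀ _ (Or.inl (mem_image_of_mem _ hu))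
      simp only [hFr, hrw, smul_apply, smul_eq_mul] at this
      rw [div_mul_eq_mul_div] at this
      rw [← div_le_iff₀ hden]
      linarith [le_abs_self (M - a t₀ d)]
    -- For inactive `t`, with `g = F - f_t(x) > ε`, the first bound gives `s a_t(d) ≤ g / 2 - ε / 4`
    -- and the second `s M ≥ -ε / 2`, so `f_t(x + s d) ≤ F + s M`.
    obtain ⟨s, hs, hsρ, hsM⟩ : ∃ s : ℝ, 0 < s ∧ s * (4 * ρ) ≤ ε ^ 2 ∧ s * (2 * |M|) ≤ ε := by
      refine ⟨min (ε ^ 2 / (4 * ρ + 1)) (ε / (2 * |M| + 1)), by positivity, ?_, ?_⟩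
      · calc _ ≤ ε ^ 2 / (4 * ρ + 1) * (4 * ρ + 1) :=
              mul_le_mul (min_le_left _ _) (by linarith) (by positivity) (by positivity)
          _ = ε ^ 2 := div_mul_cancel₀ _ (by positivity)
      · calc _ ≤ ε / (2 * |M| + 1) * (2 * |M| + 1) :=
              mul_le_mul (min_le_right _ _) (by linarith) (by positivity) (by positivity)
          _ = ε := div_mul_cancel₀ _ (by positivity)
    have hstep : ∀ t, constraint a b t (x + s • d) ≤ F + s * M := by
      intro t
      rw [constraint_add_smul]
      by_cases ht : t ∈ activeSet a b ε x
      · have := mul_le_mul_of_nonneg_left (hM0 t ht) hs.le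
        linarith [hle t]
      · have ht' : constraint a b t x < F - ε := not_le.mp fun h => ht ((hact ε t).mpr h)
        have h1 := mul_le_mul_of_nonneg_left (hpen t ht) hs.le
        set g := F - constraint a b t x with hg
        have h2 : s * (4 * ρ) * (2 * g - ε) ≤ ε ^ 2 * (2 * g - ε) :=
          mul_le_mul_of_nonneg_right hsρ (by linarith)
        have h3 : ε ^ 2 * (4 * (s * a t d)) ≤ ε ^ 2 * (2 * g - ε) := by linarith
        have h4 : 4 * (s * a t d) ≤ 2 * g - ε := le_of_mul_le_mul_left h3 (by positivity)
        have h5 := mul_le_mul_of_nonneg_left (neg_abs_le M) hs.le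
        linarith
    have := h _ _ hstep
    rw [add_sub_cancel_left, map_smul, smul_eq_mul, add_sub_cancel_left] at this
    exact le_of_mul_le_mul_left this hs

/-- A convex combination of two points satisfies the convex combination of their bounds. -/
theorem constraint_convexCombo_le {y z : X} {r q α β : ℝ} (hα : 0 ≤ α) (hβ : 0 ≤ β)
    (hαβ : α + β = 1) (hy : ∀ t, constraint a b t y ≤ r) (hz : ∀ t, constraint a b t z ≤ q)
    (t : T) : constraint a b t (α • y + β • z) ≤ α * r + β * q := by
  have h : constraint a b t (α • y + β • z) =
      α * constraint a b t y + β * constraint a b t z := by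
    simp only [constraint, map_add, map_smul, smul_eq_mul]
    linear_combination b t * hαβ
  rw [h]
  exact add_le_add (mul_le_mul_of_nonneg_left (hy t) hα) (mul_le_mul_of_nonneg_left (hz t) hβ)

/-- Existence of a Lagrange multiplier under the Slater condition. -/
theorem exists_multiplier {c : StrongDual ℝ X} {x x₀ : X} {r₀ : ℝ} (hr₀ : r₀ < 0)
    (hx₀ : ∀ t, constraint a b t x₀ ≤ r₀) (hopt : ∀ y ∈ feasibleSet a b, c x ≤ c y) :
    ∃ μ : ℝ, 0 ≤ μ ∧ ∀ (y : X) (r : ℝ), (∀ t, constraint a b t y ≤ r) → c x ≤ c y + μ * r := by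
  have hcross : ∀ (y : X) (r : ℝ), (∀ t, constraint a b t y ≤ r) → r < 0 →
      ∀ (z : X) (q : ℝ), (∀ t, constraint a b t z ≤ q) → 0 < q →
        (c x - c z) / q ≤ (c y - c x) / -r := by
    intro y r hy hr z q hz hq
    have hqr : 0 < q - r := by linarith
    -- The weights are chosen so that the bounds `r < 0 < q` combine to exactly `0`.
    have hfeas : (q / (q - r)) • y + (-r / (q - r)) • z ∈ feasibleSet a b := by
      refine mem_feasibleSet_iff.mpr fun t => ?_
      have := constraint_convexCombo_le (α := q / (q - r)) (β := -r / (q - r))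
        (by positivity) (div_nonneg (by linarith) hqr.le)
        (by rw [← add_div, ← sub_eq_add_neg, div_self hqr.ne']) hy hz t
      refine this.trans_eq ?_
      ring
    have := hopt _ hfeas
    rw [map_add, map_smul, map_smul, smul_eq_mul, smul_eq_mul, div_mul_eq_mul_div,
      div_mul_eq_mul_div, ← add_div, le_div_iff₀ hqr] at this
    rw [div_le_div_iff₀ hq (by linarith)]
    linarith
  -- The multiplier is the supremum of these slopes; Slater bounds them above, and including `0`
  -- makes it nonnegative.
  let R : Set ℝ := {m | m = 0 ∨ ∃ (z : X) (q : ℝ), (∀ t, constraint a b t z ≤ q) ∧ 0 < q ∧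
    m = (c x - c z) / q}
  have hub : ∀ (y : X) (r : ℝ), (∀ t, constraint a b t y ≤ r) → r < 0 →
      ∀ m ∈ R, m ≤ (c y - c x) / -r := by
    rintro y r hy hr m (rfl | ⟨z, q, hz, hq, rfl⟩)
    · refine div_nonneg (sub_nonneg.mpr (hopt y ?_)) (by linarith)
      exact mem_feasibleSet_iff.mpr fun t => (hy t).trans hr.le
    · exact hcross y r hy hr z q hz hq
  have hR0 : (0 : ℝ) ∈ R := Or.inl rfl
  have hbdd : BddAbove R := ⟨_, hub x₀ r₀ hx₀ hr₀⟩
  refine ⟨sSup R, le_csSup hbdd hR0, fun y r hy => ?_⟩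
  rcases lt_trichotomy r 0 with hr | rfl | hr
  · have := csSup_le ⟨0, hR0⟩ (hub y r hy hr)
    rw [le_div_iff₀ (by linarith)] at this
    linarith
  · simpa using hopt y (mem_feasibleSet_iff.mpr hy)
  · have := le_csSup hbdd (Or.inr ⟨y, r, hy, hr, rfl⟩ : (c x - c y) / r ∈ R)
    rw [div_le_iff₀ hr] at this
    linarith

end Program

end LinearInfiniteProgram

/-! ### The optimality criterion -/

open LinearInfiniteProgram

theorem corollary5p1 {X T : Type*} [AddCommGroup X] [Module ℝ X] [TopologicalSpace X]
    [IsTopologicalAddGroup X] [ContinuousSMul ℝ X] [LocallyConvexSpace ℝ X] [T2Space X]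
    [Nonempty T]
    (τ : TopologicalSpace (StrongDual ℝ X)) (hτ : LinearInfiniteProgram.IsCompatibleTopology τ)
    (c : StrongDual ℝ X) (a : T → StrongDual ℝ X) (b : T → ℝ)
    (hSlater : LinearInfiniteProgram.Slater a b)
    (x : X) (hx : x ∈ LinearInfiniteProgram.feasibleSet a b) :
    LinearInfiniteProgram.IsOptimal c a b x ↔
      (LinearInfiniteProgram.supFn a b x < 0 →
        LinearInfiniteProgram.RecessionCondition τ c a b x) ∧
      (LinearInfiniteProgram.supFn a b x = 0 →
        LinearInfiniteProgram.RecessionCondition τ c a b x ∨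
        LinearInfiniteProgram.MultiplierCondition τ c a b x) := by
  have hF := coe_toReal_supFn hx
  set F := (supFn a b x).toReal
  have hle : ∀ t, constraint a b t x ≤ F := supFn_le_coe_iff.mp hF.ge
  have hfeas0 := fun y => mem_feasibleSet_iff (a := a) (b := b) (x := y)
  have hopt_iff : IsOptimal c a b x ↔ ∀ y ∈ feasibleSet a b, c x ≤ c y :=
    ⟨fun h y hy => h.2 hy, fun h => ⟨hx, fun y hy => h y hy⟩⟩
  have hF0 : F ≤ 0 := by
    have := supFn_le_coe_iff.mpr ((hfeas0 x).mp hx)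
    rwa [← hF, EReal.coe_le_coe_iff] at this
  rw [hopt_iff, recessionCondition_iff hτ c hx, MultiplierCondition, ← hF,
    ← EReal.coe_zero, EReal.coe_lt_coe_iff, EReal.coe_eq_coe_iff]
  simp only [mem_iInter_closedCo_iff hτ hF]
  constructor
  · intro hopt
    obtain ⟨x₀, hx₀⟩ := hSlater
    have hx₀' : ((supFn a b x₀).toReal : EReal) = supFn a b x₀ :=
      EReal.coe_toReal hx₀.ne_top (supFn_ne_bot x₀)
    rw [← hx₀', ← EReal.coe_zero, EReal.coe_lt_coe_iff] at hx₀
    obtain ⟨μ, hμ, hmul⟩ := exists_multiplier hx₀ (supFn_le_coe_iff.mp hx₀'.ge) hopt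
    refine ⟨fun hneg => ?_, fun hzero => ?_⟩
    · have hμF : 0 ≤ μ * F := by linarith [hmul x F hle]
      have hμ0 : μ = 0 := le_antisymm (nonpos_of_mul_nonneg_left hμF hneg) hμ
      intro y r hy
      simpa [hμ0] using hmul y r hy
    · rcases hμ.eq_or_lt with rfl | hpos
      · exact Or.inl fun y r hy => by simpa using hmul y r hy
      · refine Or.inr ⟨μ⁻¹, inv_pos.mpr hpos, fun y r hy => ?_⟩
        have h1 : μ⁻¹ * (c x - c y) ≤ r := by
          rw [inv_mul_le_iff₀ hpos]
          linarith [hmul y r hy]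
        simp only [neg_apply, smul_apply, smul_eq_mul,
          map_sub]
        linarith
  · rintro ⟨hneg, hzero⟩ y hy
    have hy0 := (hfeas0 y).mp hy
    rcases hF0.lt_or_eq with hlt | heq
    · exact hneg hlt y 0 hy0
    · rcases hzero heq with h | ⟨l, hl, h⟩
      · exact h y 0 hy0
      · have := h y 0 hy0
        simp only [neg_apply, smul_apply, smul_eq_mul,
          map_sub, heq, sub_zero] at this
        have : 0 ≤ c y - c x := nonneg_of_mul_nonneg_right (by linarith) hl
        linarith
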